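/- Let $p\ge 1$. For a real symmetric $p\times p$ matrix $X=(x_{ij})$ write $|X|=\det X$, $X>O$ if $X$ is positive definite, $V<X$ if $X-V>O$, and $\mathrm dX=\prod_{i\ge j}\mathrm dx_{ij}$. Let $$\Gamma_p(z)=\pi^{p(p-1)/4}\prod_{j=0}^{p-1}\Gamma\!\left(z-\tfrac j2\right).$$ For a complex-valued function $f$ of a real positive definite $p\times p$ matrix, its M-transform at $s\in\mathbb C$ is $$M\{f(X);s\}=f^*(s)=\int_{X>O}|X|^{s-\frac{p+1}2}f(X)\,\mathrm dX,$$ which is said to exist if the integral converges absolutely, and its left-sided matrix Riemann–Liouville fractional integral of order $\alpha\in\mathbb C$, $\Re(\alpha)>\frac{p-1}2$, is $$({}_0D_X^{-\alpha}f)(X)=\frac1{\Gamma_p(\alpha)}\int_{O<V<X}|X-V|^{\alpha-\frac{p+1}2}f(V)\,\mathrm dV ,\qquad X>O.$$ Let $\Re(\alpha)>\frac{p-1}2$ and $\Re(s)<1$, and suppose that the M-transform $f^*(s)$ of $f$ exists at $s$. Then the integral defining $({}_0D_X^{-\alpha}f)(X)$ converges absolutely for almost every $X>O$, the M-transform of $|X|^{-\alpha}\,{}_0D_X^{-\alpha}f(X)$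 exists at $s$, and $$M\{|X|^{-\alpha}\,{}_0D_X^{-\alpha}f(X);s\}=\frac{\Gamma_p\!\left(\frac{p+1}2-s\right)}{\Gamma_p\!\left(\frac{p+1}2+\alpha-s\right)}\,f^*(s).$$ -/

import Mathlib

open MeasureTheory
open scoped Real

noncomputable section

namespace MatrixVariate

/-- Real `p × p` matrices. -/
abbrev Mat (p : ℕ) : Type := Matrix (Fin p) (Fin p) ℝ

/-- Matrices carry the product (equivalently Borel) `σ`-algebra of their entries. -/
instance instMeasurableSpaceMat (p : ℕ) : MeasurableSpace (Mat p) :=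
  inferInstanceAs (MeasurableSpace (Fin p → Fin p → ℝ))

/-- The symmetric matrix whose `(i, j)` and `(j, i)` entries are `x s(i, j)`. The unordered pairs
`s(i, j)`, with `i = j` allowed, correspond to the index pairs `i ≥ j`. -/
def symMat {p : ℕ} (x : Sym2 (Fin p) → ℝ) : Mat p :=
  Matrix.of fun i j => x s(i, j)

theorem measurable_symMat {p : ℕ} : Measurable (symMat (p := p)) :=
  measurable_pi_lambda _ fun i => measurable_pi_lambda _ fun j => measurable_pi_apply s(i, j)

/-- The measure `dX = ∏_{i ≥ j} dx_{ij}`: Lebesgue measure in the independent entries of a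
symmetric matrix, carried by the symmetric matrices. -/
def symVol (p : ℕ) : Measure (Mat p) :=
  (volume : Measure (Sym2 (Fin p) → ℝ)).map symMat

/-- The cone `{X | X > O}` of symmetric positive definite matrices. -/
def posCone (p : ℕ) : Set (Mat p) := {X | X.PosDef}

/-- The matrix interval `{V | O < V < X}`. -/
def below {p : ℕ} (X : Mat p) : Set (Mat p) := {V | V.PosDef ∧ (X - V).PosDef}

/-- `|X| ^ z`, the complex power of the determinant (used where the determinant is positive). -/
def detPow {p : ℕ} (X : Mat p) (z : ℂ) : ℂ := ((X.det : ℝ) : ℂ) ^ z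

/-- The real matrix-variate gamma function
`Γ_p(α) = π^{p(p-1)/4} Γ(α) Γ(α - 1/2) ⋯ Γ(α - (p-1)/2)`. -/
def matGamma (p : ℕ) (α : ℂ) : ℂ :=
  (π : ℂ) ^ ((p : ℂ) * ((p : ℂ) - 1) / 4) * ∏ j ∈ Finset.range p, Complex.Gamma (α - (j : ℂ) / 2)

/-- The integrand `|X| ^ (s - (p+1)/2) f(X)` of the M-transform. -/
def mIntegrand {p : ℕ} (f : Mat p → ℂ) (s : ℂ) (X : Mat p) : ℂ :=
  detPow X (s - ((p : ℂ) + 1) / 2) * f X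

/-- The M-transform of `f` exists at `s`: its defining integral converges absolutely. -/
def HasMTransform {p : ℕ} (f : Mat p → ℂ) (s : ℂ) : Prop :=
  IntegrableOn (mIntegrand f s) (posCone p) (symVol p)

/-- The M-transform `M{f; s} = f*(s) = ∫_{X > O} |X| ^ (s - (p+1)/2) f(X) dX`. -/
def mTransform {p : ℕ} (f : Mat p → ℂ) (s : ℂ) : ℂ :=
  ∫ X in posCone p, mIntegrand f s X ∂(symVol p)

/-- The integrand `V ↦ |X - V| ^ (α - (p+1)/2) f(V)` of the fractional integral at `X`. -/
def rlIntegrand {p : ℕ} (α : ℂ) (f : Mat p → ℂ) (X V : Mat p) : ℂ :=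
  detPow (X - V) (α - ((p : ℂ) + 1) / 2) * f V

/-- The left-sided matrix Riemann–Liouville fractional integral
`(₀D_X^{-α} f)(X) = 1/Γ_p(α) ∫_{O < V < X} |X - V| ^ (α - (p+1)/2) f(V) dV`. -/
def leftRL {p : ℕ} (α : ℂ) (f : Mat p → ℂ) (X : Mat p) : ℂ :=
  (1 / matGamma p α) * ∫ V in below X, rlIntegrand α f X V ∂(symVol p)

end MatrixVariate

end

noncomputable section

namespace MatrixVariate

open Matrix Set

/-! ### Measurability on matrices -/

/-! Put b = (p+1)/2 - s, so that the weight of the M-transform is |X|^(-b). Fubini reduces the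
theorem to integrating |X|^(-(α+b)) |X - V|^(α-(p+1)/2) over X > V for fixed V. After X = Z + V this
is a beta integral of the second kind, equal to Γ_p(α) Γ_p(b) / Γ_p(α+b) · |V|^(-b) (`beta_detPow`);
here |V|^(-b) restores the weight of f*, and Γ_p(α) cancels the normalization of the fractional
integral.

The beta integral comes from the Laplace transform of |W|^(a-(p+1)/2), which is Γ_p(a) |V|^(-a)
(`laplace_detPow`): represent |Z + V|^(-(a+b)) as such a transform and integrate over Z first. The
Laplace transform is computed by induction on p. Splitting off the last row and column, with the
Schur complement of the corner as coordinate, the integrand separates into a Gaussian in the column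
(`gaussian_quadForm_inv`), a one-dimensional Gamma integral (`gamma_kernel`), and the same problem
in size p.

Absolute convergence costs nothing new: norms replace exponents by their real parts, so the same
formulas evaluate the integrals of norms, and Tonelli applies (`integrable_rlKernel`). -/

instance instBorelSpaceMat (p : ℕ) : BorelSpace (Mat p) :=
  inferInstanceAs (BorelSpace (Fin p → Fin p → ℝ))

instance instSecondCountableMat (p : ℕ) : SecondCountableTopology (Mat p) :=
  inferInstanceAs (SecondCountableTopology (Fin p → Fin p → ℝ))

instance instSFiniteSymVol (p : ℕ) : SFinite (symVol p) := by
  unfold symVol; infer_instance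

variable {p : ℕ}

theorem measurable_det : Measurable fun X : Mat p => X.det :=
  (continuous_id.matrix_det).measurable

theorem measurable_detPow (z : ℂ) : Measurable fun X : Mat p => detPow X z :=
  (Complex.measurable_ofReal.comp measurable_det).pow_const z

theorem measurable_inv : Measurable fun X : Mat p => X⁻¹ := by
  have h : (fun X : Mat p => X⁻¹) = fun X => X.det⁻¹ • X.adjugate := by
    funext X; rw [inv_def, Ring.inverse_eq_inv']
  rw [h]
  refine measurable_pi_iff.2 fun i => measurable_pi_iff.2 fun j => ?_
  have h2 : Measurable fun X : Mat p => X.adjugate i j :=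
    (((continuous_id (X := Mat p)).matrix_adjugate).matrix_elem i j).measurable
  exact measurable_det.inv.mul h2

/-- Semidefiniteness is a closed condition, and within it definiteness is nonvanishing of the
determinant. -/
theorem measurableSet_posCone : MeasurableSet (posCone p) := by
  have h : posCone p = {X : Mat p | X.IsHermitian} ∩
      (⋂ x : Fin p → ℝ, {X : Mat p | 0 ≤ x ⬝ᵥ X *ᵥ x}) ∩ {X : Mat p | X.det ≠ 0} := by
    ext X
    simp only [posCone, mem_ofPred_eq, mem_inter_iff, mem_iInter]
    constructor
    · intro h
      exact ⟨⟨h.1, fun x => by simpa using h.posSemidef.dotProduct_mulVec_nonneg x⟩, h.det_pos.ne'⟩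
    · rintro ⟨⟨h1, h2⟩, h3⟩
      exact (PosSemidef.of_dotProduct_mulVec_nonneg h1
        (fun x => by simpa using h2 x)).posDef_iff_det_ne_zero.2 h3
  rw [h]
  refine (MeasurableSet.inter ?_ ?_).inter ?_
  · exact (isClosed_eq (continuous_id.matrix_conjTranspose) continuous_id).measurableSet
  · refine (isClosed_iInter fun x => isClosed_le continuous_const ?_).measurableSet
    exact continuous_const.dotProduct (continuous_id.matrix_mulVec continuous_const)
  · exact (measurable_det (measurableSet_singleton 0)).compl

/-! ### Symmetric matrices, determinant powers and Γ_p -/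

theorem exists_symMat_eq {X : Mat p} (hX : X.IsSymm) : ∃ x, symMat x = X := by
  refine ⟨fun z => Sym2.lift ⟨fun i j => X i j, fun i j => (hX.apply j i)⟩ z, ?_⟩
  ext i j; simp [symMat]

theorem isSymm_of_posDef {X : Mat p} (h : X.PosDef) : X.IsSymm := by
  have := h.1
  rwa [IsHermitian, conjTranspose_eq_transpose_of_trivial] at this

/-- `symVol` is invariant under translations by symmetric matrices. -/
theorem measurePreserving_add_left {V : Mat p} (hV : V.IsSymm) :
    MeasurePreserving (fun X => X + V) (symVol p) (symVol p) := by
  obtain ⟨v, rfl⟩ := exists_symMat_eq hV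
  have hm : Measurable fun X : Mat p => X + symMat v :=
    (continuous_id.add continuous_const).measurable
  refine ⟨hm, ?_⟩
  have h : (fun X : Mat p => X + symMat v) ∘ symMat = symMat ∘ fun x => x + v := by
    funext x; ext i j; rfl
  conv_lhs => rw [symVol, Measure.map_map hm measurable_symMat, h,
    ← Measure.map_map measurable_symMat (measurable_add_const v), map_add_right_eq_self]
  rfl

theorem detPow_add {X : Mat p} (hX : X.PosDef) (a b : ℂ) :
    detPow X (a + b) = detPow X a * detPow X b :=
  Complex.cpow_add _ _ (Complex.ofReal_ne_zero.2 hX.det_pos.ne')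

theorem norm_detPow {X : Mat p} (hX : X.PosDef) (a : ℂ) : ‖detPow X a‖ = X.det ^ a.re :=
  Complex.norm_cpow_eq_rpow_re_of_pos hX.det_pos _

theorem detPow_ofReal {X : Mat p} (hX : X.PosDef) (a : ℝ) :
    detPow X a = ((X.det ^ a : ℝ) : ℂ) :=
  (Complex.ofReal_cpow hX.det_pos.le a).symm

theorem detPow_ne_zero {X : Mat p} (hX : X.PosDef) (a : ℂ) : detPow X a ≠ 0 := by
  rw [← norm_ne_zero_iff, norm_detPow hX]
  exact (Real.rpow_pos_of_pos hX.det_pos _).ne'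

theorem matGamma_ne_zero {a : ℂ} (ha : ((p : ℝ) - 1) / 2 < a.re) : matGamma p a ≠ 0 := by
  refine mul_ne_zero ?_ (Finset.prod_ne_zero_iff.2 fun j hj => ?_)
  · simp [Complex.cpow_eq_zero_iff, Real.pi_ne_zero]
  · apply Complex.Gamma_ne_zero_of_re_pos
    have h1 : (j : ℝ) + 1 ≤ p := by exact_mod_cast Finset.mem_range.1 hj
    have h2 : ((j : ℂ) / 2).re = (j : ℝ) / 2 := by
      rw [show ((j : ℂ) / 2) = (((j : ℝ) / 2 : ℝ) : ℂ) by push_cast; rfl, Complex.ofReal_re]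
    rw [Complex.sub_re, h2]; linarith

/-- In the induction, the power of π comes from the Gaussian integral over the border column and the
new Gamma factor from the Schur complement. -/
theorem matGamma_succ (a : ℂ) :
    matGamma (p + 1) a = matGamma p a * ((π : ℂ) ^ ((p : ℂ) / 2) * Complex.Gamma (a - p / 2)) := by
  have hpi : (π : ℂ) ≠ 0 := Complex.ofReal_ne_zero.2 Real.pi_ne_zero
  rw [matGamma, matGamma, Finset.prod_range_succ,
    show ((p + 1 : ℕ) : ℂ) * (((p + 1 : ℕ) : ℂ) - 1) / 4 = (p : ℂ) * ((p : ℂ) - 1) / 4 + p / 2 by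
      push_cast; ring, Complex.cpow_add _ _ hpi]
  ring

/-! ### Bordered matrices -/

theorem trace_submatrix_equiv {m n : Type*} [Fintype m] [Fintype n] (A : Matrix n n ℝ)
    (e : m ≃ n) : (A.submatrix e e).trace = A.trace :=
  e.sum_comp fun i => A i i

/-- The symmetric matrix obtained from `A` by adding the last column `u` and last diagonal entry
`w`. -/
def border (A : Mat p) (u : Fin p → ℝ) (w : ℝ) : Mat (p + 1) :=
  (fromBlocks A (replicateCol (Fin 1) u) (replicateRow (Fin 1) u)
    (of fun _ _ => w)).submatrix finSumFinEquiv.symm finSumFinEquiv.symm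

theorem measurable_border :
    Measurable fun q : (Mat p × (Fin p → ℝ)) × ℝ => border q.1.1 q.1.2 q.2 := by
  apply Continuous.measurable
  unfold border
  refine Continuous.matrix_submatrix (Continuous.matrix_fromBlocks ?_ ?_ ?_ ?_) _ _
  · fun_prop
  · exact continuous_matrix fun i j => by simp only [replicateCol_apply]; fun_prop
  · exact continuous_matrix fun i j => by simp only [replicateRow_apply]; fun_prop
  · exact continuous_matrix fun i j => by simp only [of_apply]; fun_prop

theorem exists_border_eq {V : Mat (p + 1)} (hV : V.IsSymm) : ∃ A u w, V = border A u w := by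
  refine ⟨V.submatrix Fin.castSucc Fin.castSucc, fun i => V i.castSucc (Fin.last p),
    V (Fin.last p) (Fin.last p), ?_⟩
  have h : V.submatrix finSumFinEquiv finSumFinEquiv =
      fromBlocks (V.submatrix Fin.castSucc Fin.castSucc)
      (replicateCol (Fin 1) fun i => V i.castSucc (Fin.last p))
      (replicateRow (Fin 1) fun i => V i.castSucc (Fin.last p))
      (of fun _ _ => V (Fin.last p) (Fin.last p)) := by
    ext (i | i) (j | j)
    · rfl
    · fin_cases j; rfl
    · fin_cases i; exact hV.apply _ _
    · fin_cases i; fin_cases j; rfl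
  rw [border, ← h]; simp

theorem trace_border_mul (A B : Mat p) (u v : Fin p → ℝ) (w z : ℝ) :
    (border A u w * border B v z).trace = (A * B).trace + 2 * (u ⬝ᵥ v) + w * z := by
  rw [border, border, submatrix_mul_equiv, fromBlocks_multiply,
    trace_submatrix_equiv]
  have h1 : (replicateCol (Fin 1) u * replicateRow (Fin 1) v).trace = u ⬝ᵥ v := by
    simp [trace, mul_apply, dotProduct]
  have h2 : (replicateRow (Fin 1) u * replicateCol (Fin 1) v).trace = u ⬝ᵥ v := by
    simp [trace, mul_apply, dotProduct]
  have h3 : ((of fun _ _ => w : Matrix (Fin 1) (Fin 1) ℝ) * of fun _ _ => z).trace = w * z := by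
    simp [trace, mul_apply]
  have h4 (P : Matrix (Fin p) (Fin p) ℝ) (Q : Matrix (Fin p) (Fin 1) ℝ)
      (R : Matrix (Fin 1) (Fin p) ℝ) (S : Matrix (Fin 1) (Fin 1) ℝ) :
      (fromBlocks P Q R S).trace = P.trace + S.trace := by simp [trace]
  rw [h4, trace_add, trace_add, h1, h2, h3]; ring

theorem schurComplement_border (A : Mat p) (u : Fin p → ℝ) (w : ℝ) :
    (of fun _ _ => w : Matrix (Fin 1) (Fin 1) ℝ) -
      replicateRow (Fin 1) u * A⁻¹ * replicateCol (Fin 1) u = of fun _ _ => w - u ⬝ᵥ A⁻¹ *ᵥ u := by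
  ext i j
  rw [Matrix.mul_assoc, Matrix.sub_apply, mul_apply]
  simp [dotProduct, mulVec, mul_apply]

theorem det_border {A : Mat p} (hA : A.PosDef) (u : Fin p → ℝ) (t : ℝ) :
    (border A u (t + u ⬝ᵥ A⁻¹ *ᵥ u)).det = A.det * t := by
  let _ := hA.isUnit.invertible
  rw [border, det_submatrix_equiv_self, det_fromBlocks₁₁, invOf_eq_nonsing_inv,
    schurComplement_border, add_sub_cancel_right, det_fin_one, of_apply]

theorem conjTranspose_replicateCol_real (u : Fin p → ℝ) :
    (replicateCol (Fin 1) u)ᴴ = replicateRow (Fin 1) u := by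
  ext i j; simp

/-- With the Schur complement `t` as coordinate, the cone becomes a product: no condition on `u`,
and `A` and `t` decouple. -/
theorem posDef_border_iff {A : Mat p} {u : Fin p → ℝ} {t : ℝ} :
    (border A u (t + u ⬝ᵥ A⁻¹ *ᵥ u)).PosDef ↔ A.PosDef ∧ 0 < t := by
  constructor
  · intro h
    have hA : A.PosDef := by
      have h1 := h.submatrix (Fin.castSucc_injective p)
      convert h1 using 1
      ext i j
      simp [border]
    refine ⟨hA, ?_⟩
    have h2 := h.det_pos
    rw [det_border hA] at h2
    exact (pos_iff_pos_of_mul_pos h2).1 hA.det_pos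
  · rintro ⟨hA, ht⟩
    -- The Schur criterion gives semidefiniteness; the determinant then makes it strict.
    have h0 : (border A u (t + u ⬝ᵥ A⁻¹ *ᵥ u)).PosSemidef := by
      let _ := hA.isUnit.invertible
      rw [border, posSemidef_submatrix_equiv, ← conjTranspose_replicateCol_real,
        PosDef.fromBlocks₁₁ _ _ hA, conjTranspose_replicateCol_real, schurComplement_border,
        add_sub_cancel_right]
      rw [show (of fun _ _ => t : Matrix (Fin 1) (Fin 1) ℝ) = Matrix.diagonal fun _ => t by
        ext i j; simp [Subsingleton.elim i j]]
      exact PosSemidef.diagonal fun _ => ht.le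
    rw [h0.posDef_iff_det_ne_zero, det_border hA]
    exact (mul_pos hA.det_pos ht).ne'

theorem inv_of_const (b : ℝ) : (of fun _ _ => b : Matrix (Fin 1) (Fin 1) ℝ)⁻¹ =
    of fun _ _ => b⁻¹ := by
  ext i j
  simp [Subsingleton.elim i j]

theorem schurComplement_border' (B : Mat p) (v : Fin p → ℝ) (b : ℝ) :
    B - replicateCol (Fin 1) v * (of fun _ _ => b : Matrix (Fin 1) (Fin 1) ℝ)⁻¹ *
      replicateRow (Fin 1) v = B - b⁻¹ • vecMulVec v v := by
  rw [inv_of_const]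
  ext i j
  simp [mul_apply, vecMulVec_apply]
  ring

/-- Here the corner is eliminated instead of the block. This form suits the Laplace parameter, whose
Schur complement appears when the Gaussian square is completed. -/
theorem det_border' (B : Mat p) (v : Fin p → ℝ) {b : ℝ} (hb : b ≠ 0) :
    (border B v b).det = b * (B - b⁻¹ • vecMulVec v v).det := by
  have hu : IsUnit (of fun _ _ => b : Matrix (Fin 1) (Fin 1) ℝ) := by
    rw [isUnit_iff_isUnit_det, det_unique]; exact hb.isUnit
  let _ := hu.invertible
  rw [border, det_submatrix_equiv_self, det_fromBlocks₂₂, invOf_eq_nonsing_inv,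
    schurComplement_border', det_unique, of_apply]

theorem posDef_of_posDef_border {B : Mat p} {v : Fin p → ℝ} {b : ℝ} (h : (border B v b).PosDef) :
    0 < b ∧ (B - b⁻¹ • vecMulVec v v).PosDef := by
  have hb : 0 < b := by
    have := h.diag_pos (i := Fin.last p)
    simpa [border] using this
  refine ⟨hb, ?_⟩
  have hD : (of fun _ _ => b : Matrix (Fin 1) (Fin 1) ℝ).PosDef := by
    rw [show (of fun _ _ => b : Matrix (Fin 1) (Fin 1) ℝ) = Matrix.diagonal fun _ => b by
      ext i j; simp [Subsingleton.elim i j]]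
    exact PosDef.diagonal fun _ => hb
  have h0 : (B - b⁻¹ • vecMulVec v v).PosSemidef := by
    let _ := hD.isUnit.invertible
    have h1 := h.posSemidef
    rwa [border, posSemidef_submatrix_equiv, ← conjTranspose_replicateCol_real,
      PosDef.fromBlocks₂₂ _ _ hD, conjTranspose_replicateCol_real, schurComplement_border'] at h1
  have h2 := h.det_pos
  rw [det_border' B v hb.ne'] at h2
  exact h0.posDef_iff_det_ne_zero.2 (right_ne_zero_of_mul h2.ne')

/-! ### Block decomposition of the measure -/

/-- Unordered pairs in `Fin (p + 1)`: those in `Fin p`, those of an element of `Fin p` and the last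
element, and the diagonal pair of the last element. -/
def sym2SuccEquiv (p : ℕ) : (Sym2 (Fin p) ⊕ Fin p) ⊕ Fin 1 ≃ Sym2 (Fin (p + 1)) :=
  Equiv.ofBijective
    (Sum.elim (Sum.elim (Sym2.map Fin.castSucc) fun i => s(i.castSucc, Fin.last p))
      fun _ => s(Fin.last p, Fin.last p)) <| by
    constructor
    · rintro ((a | a) | a) ((b | b) | b) h
      · simpa using (Sym2.map.injective (Fin.castSucc_injective p)) h
      · induction a with | _ x y => simp [Fin.castSucc_ne_last] at h
      · induction a with | _ x y => simp [Fin.castSucc_ne_last] at h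
      · induction b with | _ x y => simp [(Fin.castSucc_ne_last _).symm] at h
      · simpa [Fin.castSucc_ne_last] using h
      · simp [Fin.castSucc_ne_last] at h
      · induction b with | _ x y => simp [(Fin.castSucc_ne_last _).symm] at h
      · simp [(Fin.castSucc_ne_last _).symm] at h
      · simp [Subsingleton.elim a b]
    · intro z
      induction z with
      | _ x y =>
        induction x using Fin.lastCases with
        | last =>
          induction y using Fin.lastCases with
          | last => exact ⟨.inr 0, rfl⟩
          | cast j => exact ⟨.inl (.inr j), Sym2.eq_swap⟩
        | cast i =>
          induction y using Fin.lastCases with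
          | last => exact ⟨.inl (.inr i), rfl⟩
          | cast j => exact ⟨.inl (.inl s(i, j)), rfl⟩

/-- Bordering only reindexes the independent entries, so product Lebesgue measure is carried to
itself. -/
theorem measurePreserving_border :
    MeasurePreserving (fun q : (Mat p × (Fin p → ℝ)) × ℝ => border q.1.1 q.1.2 q.2)
      (((symVol p).prod volume).prod volume) (symVol (p + 1)) := by
  have hs (n : ℕ) : MeasurePreserving (symMat (p := n)) volume (symVol n) := ⟨measurable_symMat, rfl⟩
  have h1 : MeasurePreserving
      (Prod.map (Prod.map (symMat (p := p)) id) id :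
        ((Sym2 (Fin p) → ℝ) × (Fin p → ℝ)) × ℝ → (Mat p × (Fin p → ℝ)) × ℝ)
      ((volume.prod volume).prod volume) (((symVol p).prod volume).prod volume) :=
    ((hs p).prod (.id _)).prod (.id _)
  have h2 := (volume_measurePreserving_sumPiEquivProdPi_symm
    (fun _ : Sym2 (Fin p) ⊕ Fin p => ℝ)).prod
    (volume_preserving_funUnique (Fin 1) ℝ).symm
  have h3 := (volume_measurePreserving_sumPiEquivProdPi_symm
    (fun _ : (Sym2 (Fin p) ⊕ Fin p) ⊕ Fin 1 => ℝ)).comp h2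
  have h4 := (hs (p + 1)).comp
    ((volume_measurePreserving_piCongrLeft (fun _ => ℝ) (sym2SuccEquiv p)).comp h3)
  refine ⟨measurable_border, ?_⟩
  rw [← h1.map_eq, Measure.map_map measurable_border h1.measurable, ← h4.map_eq]
  congr 1
  funext ⟨⟨x, u⟩, t⟩
  have key (k : (Sym2 (Fin p) ⊕ Fin p) ⊕ Fin 1) :
      (MeasurableEquiv.piCongrLeft (fun _ => ℝ) (sym2SuccEquiv p)
        ((MeasurableEquiv.sumPiEquivProdPi fun _ : (Sym2 (Fin p) ⊕ Fin p) ⊕ Fin 1 => ℝ).symm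
          ((MeasurableEquiv.sumPiEquivProdPi fun _ : Sym2 (Fin p) ⊕ Fin p => ℝ).symm (x, u),
            (MeasurableEquiv.funUnique (Fin 1) ℝ).symm t))) (sym2SuccEquiv p k) =
      Sum.elim (Sum.elim x u) (fun _ => t) k := by
    refine (Equiv.piCongrLeft_apply_apply (fun _ => ℝ) (sym2SuccEquiv p) _ k).trans ?_
    rcases k with (k | k) | k <;> rfl
  ext i j
  induction i using Fin.lastCases with
  | last =>
    induction j using Fin.lastCases with
    | last =>
      refine Eq.trans ?_ (key (.inr 0)).symm
      simp [border]
    | cast j =>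
      refine Eq.trans ?_ ((key (.inl (.inr j))).symm.trans (congrArg _ Sym2.eq_swap))
      simp [border]
  | cast i =>
    induction j using Fin.lastCases with
    | last =>
      refine Eq.trans ?_ (key (.inl (.inr i))).symm
      simp [border]
    | cast j =>
      refine Eq.trans ?_ (key (.inl (.inl s(i, j)))).symm
      simp [border, symMat]

theorem measurable_quadForm_inv :
    Measurable fun a : Mat p × (Fin p → ℝ) => a.2 ⬝ᵥ a.1⁻¹ *ᵥ a.2 := by
  have h : Continuous fun a : Mat p × (Fin p → ℝ) => a.2 ⬝ᵥ a.1 *ᵥ a.2 :=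
    continuous_snd.dotProduct (continuous_fst.matrix_mulVec continuous_snd)
  exact h.measurable.comp ((measurable_inv.comp measurable_fst).prodMk measurable_snd)

/-- Block coordinates on the cone of positive definite matrices: the last diagonal entry is
parametrized by its Schur complement. -/
theorem measurePreserving_border_posCone :
    MeasurePreserving (fun q : (Mat p × (Fin p → ℝ)) × ℝ =>
        border q.1.1 q.1.2 (q.2 + q.1.2 ⬝ᵥ q.1.1⁻¹ *ᵥ q.1.2))
      ((((symVol p).restrict (posCone p)).prod volume).prod (volume.restrict (Ioi 0)))
      ((symVol (p + 1)).restrict (posCone (p + 1))) := by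
  -- A shear: for fixed `(A, u)` it translates the last coordinate.
  have h1 : MeasurePreserving (fun q : (Mat p × (Fin p → ℝ)) × ℝ =>
      (q.1, q.2 + q.1.2 ⬝ᵥ q.1.1⁻¹ *ᵥ q.1.2))
      (((symVol p).prod volume).prod volume) (((symVol p).prod volume).prod volume) :=
    (MeasurePreserving.id _).skew_product
      (g := fun (a : Mat p × (Fin p → ℝ)) (t : ℝ) => t + a.2 ⬝ᵥ a.1⁻¹ *ᵥ a.2)
      (measurable_snd.add (measurable_quadForm_inv.comp measurable_fst))
      (Filter.Eventually.of_forall fun a => map_add_right_eq_self volume _)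
  have h2 := (measurePreserving_border.comp h1).restrict_preimage measurableSet_posCone
  refine Eq.mp (congrArg (fun μ => MeasurePreserving _ μ _) ?_) h2
  symm
  rw [← Measure.restrict_univ (μ := (volume : Measure (Fin p → ℝ))), Measure.prod_restrict,
    Measure.prod_restrict, Measure.restrict_univ]
  congr 1
  ext ⟨⟨A, u⟩, t⟩
  simpa [posCone] using posDef_border_iff.symm

/-! ### The Gaussian integral of a positive definite quadratic form -/

section
open scoped MatrixOrder Matrix.Norms.L2Operator

theorem exists_eq_mul_transpose {A : Mat p} (hA : A.PosDef) : ∃ B : Mat p, A = B * Bᵀ := by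
  obtain ⟨y, hy⟩ := CStarAlgebra.nonneg_iff_eq_star_mul_self.mp hA.posSemidef.nonneg
  refine ⟨yᵀ, ?_⟩
  rw [hy, star_eq_conjTranspose, conjTranspose_eq_transpose_of_trivial, transpose_transpose]

end

theorem gaussian_sum {b : ℝ} (hb : 0 < b) (c : Fin p → ℝ) :
    Integrable (fun y : Fin p → ℝ => Real.exp (-(2 * (y ⬝ᵥ c) + b * (y ⬝ᵥ y)))) ∧
    ∫ y : Fin p → ℝ, Real.exp (-(2 * (y ⬝ᵥ c) + b * (y ⬝ᵥ y))) =
      (π / b) ^ ((p : ℝ) / 2) * Real.exp (b⁻¹ * (c ⬝ᵥ c)) := by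
  have hb' : 0 < (b : ℂ).re := by simpa using hb
  have h (y : Fin p → ℝ) : Complex.exp (-(b : ℂ) * ∑ i, (y i : ℂ) ^ 2 +
      ∑ i, ((-2 * c i : ℝ) : ℂ) * y i) =
      ((Real.exp (-(2 * (y ⬝ᵥ c) + b * (y ⬝ᵥ y))) : ℝ) : ℂ) := by
    rw [Complex.ofReal_exp]
    congr 1
    simp only [dotProduct, Complex.ofReal_neg, Complex.ofReal_add, Complex.ofReal_mul,
      Complex.ofReal_sum, Finset.mul_sum, ← Finset.sum_add_distrib, ← Finset.sum_neg_distrib]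
    refine Finset.sum_congr rfl fun i _ => ?_
    push_cast; ring
  have h1 := GaussianFourier.integrable_cexp_neg_mul_sum_add hb' fun i => ((-2 * c i : ℝ) : ℂ)
  have h2 := GaussianFourier.integral_cexp_neg_mul_sum_add hb' fun i => ((-2 * c i : ℝ) : ℂ)
  simp only [h] at h1 h2
  refine ⟨h1.re, ?_⟩
  rw [integral_complex_ofReal] at h2
  apply Complex.ofReal_injective
  rw [h2, Complex.ofReal_mul, Complex.ofReal_exp, Complex.ofReal_cpow (by positivity)]
  congr 2
  · simp
  · simp
  · simp only [dotProduct, Complex.ofReal_mul, Complex.ofReal_sum, Finset.mul_sum, Finset.sum_div]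
    refine Finset.sum_congr rfl fun i _ => ?_
    have : (b : ℂ) ≠ 0 := Complex.ofReal_ne_zero.2 hb.ne'
    push_cast
    field_simp
    ring

/-- Write A = B Bᵀ and substitute u = B y: the form in A⁻¹ becomes y · y, and the Jacobian is |det
B| = |A|^(1/2). -/
theorem gaussian_quadForm_inv {A : Mat p} (hA : A.PosDef) {b : ℝ} (hb : 0 < b) (v : Fin p → ℝ) :
    Integrable (fun u : Fin p → ℝ => Real.exp (-(2 * (u ⬝ᵥ v) + b * (u ⬝ᵥ A⁻¹ *ᵥ u)))) ∧
    ∫ u : Fin p → ℝ, Real.exp (-(2 * (u ⬝ᵥ v) + b * (u ⬝ᵥ A⁻¹ *ᵥ u))) =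
      (π / b) ^ ((p : ℝ) / 2) * A.det ^ (1 / 2 : ℝ) * Real.exp (b⁻¹ * (v ⬝ᵥ A *ᵥ v)) := by
  obtain ⟨B, hB⟩ := exists_eq_mul_transpose hA
  have hdet : A.det = B.det ^ 2 := by rw [hB, det_mul, det_transpose, sq]
  have hB0 : B.det ≠ 0 := fun h => hA.det_pos.ne' (by rw [hdet, h]; simp)
  have hBu : IsUnit B.det := hB0.isUnit
  have hBtu : IsUnit (Bᵀ).det := by rwa [det_transpose]
  have hF (y : Fin p → ℝ) : 2 * ((B *ᵥ y) ⬝ᵥ v) + b * ((B *ᵥ y) ⬝ᵥ A⁻¹ *ᵥ (B *ᵥ y)) =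
      2 * (y ⬝ᵥ (Bᵀ *ᵥ v)) + b * (y ⬝ᵥ y) := by
    have h1 (w : Fin p → ℝ) : (B *ᵥ y) ⬝ᵥ w = y ⬝ᵥ (Bᵀ *ᵥ w) := by
      rw [mulVec_transpose, dotProduct_comm, dotProduct_mulVec, dotProduct_comm]
    rw [h1, h1, mulVec_mulVec, mulVec_mulVec, hB, Matrix.mul_inv_rev, Matrix.mul_assoc,
      Matrix.mul_assoc, nonsing_inv_mul _ hBu, Matrix.mul_one, mul_nonsing_inv _ hBtu, one_mulVec]
  have hvA : v ⬝ᵥ A *ᵥ v = (Bᵀ *ᵥ v) ⬝ᵥ (Bᵀ *ᵥ v) := by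
    rw [hB, ← mulVec_mulVec, dotProduct_mulVec, mulVec_transpose]
  have hmap := Real.map_matrix_volume_pi_eq_smul_volume_pi hB0
  have hlin : Measurable (toLin' B : (Fin p → ℝ) → Fin p → ℝ) :=
    (LinearMap.continuous_of_finiteDimensional _).measurable
  have hmeas (μ : Measure (Fin p → ℝ)) : AEStronglyMeasurable
      (fun u : Fin p → ℝ => Real.exp (-(2 * (u ⬝ᵥ v) + b * (u ⬝ᵥ A⁻¹ *ᵥ u)))) μ := by
    apply Continuous.aestronglyMeasurable
    have : Continuous fun u : Fin p → ℝ => A⁻¹ *ᵥ u := continuous_const.matrix_mulVec continuous_id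
    have h1 : Continuous fun u : Fin p → ℝ => u ⬝ᵥ A⁻¹ *ᵥ u := continuous_id.dotProduct this
    have h2 : Continuous fun u : Fin p → ℝ => u ⬝ᵥ v := continuous_id.dotProduct continuous_const
    fun_prop
  obtain ⟨g1, g2⟩ := gaussian_sum hb (Bᵀ *ᵥ v)
  have habs : 0 < |B.det| := abs_pos.2 hB0
  have hsq : A.det ^ (1 / 2 : ℝ) = |B.det| := by
    rw [hdet, ← Real.sqrt_eq_rpow, Real.sqrt_sq_eq_abs]
  constructor
  · have h1 : Integrable (fun u : Fin p → ℝ =>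
        Real.exp (-(2 * (u ⬝ᵥ v) + b * (u ⬝ᵥ A⁻¹ *ᵥ u)))) (Measure.map (toLin' B) volume) := by
      rw [integrable_map_measure (hmeas _) hlin.aemeasurable]
      simpa only [Function.comp_def, toLin'_apply, hF] using g1
    rw [hmap, integrable_smul_measure (by simpa using hB0) ENNReal.ofReal_ne_top] at h1
    exact h1
  · have h1 := integral_map (μ := volume) hlin.aemeasurable (hmeas _)
    simp only [toLin'_apply, hF] at h1
    rw [hmap, integral_smul_measure, g2, ENNReal.toReal_ofReal (abs_nonneg _), abs_inv,
      smul_eq_mul, inv_mul_eq_iff_eq_mul₀ habs.ne'] at h1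
    rw [h1, hsq, hvA]; ring

/-! ### The Laplace transform of a power of the determinant -/

/-- The integrand `|W| ^ (a - (p+1)/2) exp(-tr(WV))`. -/
def laplaceIntegrand (a : ℂ) (V W : Mat p) : ℂ :=
  detPow W (a - ((p : ℂ) + 1) / 2) * (Real.exp (-(W * V).trace) : ℝ)

theorem measurable_laplaceIntegrand (a : ℂ) :
    Measurable fun q : Mat p × Mat p => laplaceIntegrand a q.1 q.2 := by
  refine ((measurable_detPow _).comp measurable_snd).mul (Complex.measurable_ofReal.comp ?_)
  refine Real.measurable_exp.comp (Continuous.measurable ?_)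
  exact (continuous_snd.matrix_mul continuous_fst).matrix_trace.neg

theorem measurable_laplaceIntegrand_right (a : ℂ) (V : Mat p) :
    Measurable (laplaceIntegrand a V) := by
  have h := (measurable_laplaceIntegrand (p := p) a).comp (measurable_prodMk_left (x := V))
  exact h

/-- Makes the integral of the norm another instance of the Laplace transform, with a real exponent.
-/
theorem norm_laplaceIntegrand (a : ℂ) (V : Mat p) {W : Mat p} (hW : W.PosDef) :
    (‖laplaceIntegrand a V W‖ : ℂ) = laplaceIntegrand (a.re : ℂ) V W := by
  have h : ((a.re : ℂ) - ((p : ℂ) + 1) / 2) = ((a.re - ((p : ℝ) + 1) / 2 : ℝ) : ℂ) := by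
    push_cast; ring
  have h2 : (a - ((p : ℂ) + 1) / 2).re = a.re - ((p : ℝ) + 1) / 2 := by
    rw [show ((p : ℂ) + 1) / 2 = (((p : ℝ) + 1) / 2 : ℝ) by push_cast; ring, Complex.sub_re,
      Complex.ofReal_re]
  rw [laplaceIntegrand, laplaceIntegrand, h, detPow_ofReal hW, norm_mul, norm_detPow hW, h2,
    Complex.norm_real, Real.norm_of_nonneg (Real.exp_pos _).le, Complex.ofReal_mul]

theorem gamma_kernel {c : ℂ} (hc : 0 < c.re) {b : ℝ} (hb : 0 < b) :
    IntegrableOn (fun t : ℝ => (t : ℂ) ^ (c - 1) * (Real.exp (-(b * t)) : ℝ)) (Ioi 0) ∧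
    ∫ t in Ioi (0 : ℝ), (t : ℂ) ^ (c - 1) * (Real.exp (-(b * t)) : ℝ) =
      (b : ℂ) ^ (-c) * Complex.Gamma c := by
  constructor
  · have h := integrableOn_rpow_mul_exp_neg_mul_rpow (s := c.re - 1) (p := 1) (b := b)
      (by linarith) one_pos hb
    refine (integrable_norm_iff ?_).1 (h.congr_fun ?_ measurableSet_Ioi)
    · refine Measurable.aestronglyMeasurable ?_
      exact (Complex.measurable_ofReal.pow_const _).mul (by fun_prop)
    · intro t ht
      simp only [Real.rpow_one, norm_mul]
      rw [Complex.norm_cpow_eq_rpow_re_of_pos ht, Complex.norm_real,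
        Real.norm_of_nonneg (Real.exp_pos _).le]
      simp
  · have h := Complex.integral_cpow_mul_exp_neg_mul_Ioi hc hb
    simp only [Complex.ofReal_exp, Complex.ofReal_neg, Complex.ofReal_mul]
    rw [h, one_div, Complex.inv_cpow _ _ (by
      rw [Complex.arg_ofReal_of_nonneg hb.le]; exact Real.pi_ne_zero.symm), Complex.cpow_neg]

theorem laplaceIntegrand_border (a : ℂ) (B A : Mat p) (v u : Fin p → ℝ) (b : ℝ) {t : ℝ}
    (hA : A.PosDef) (ht : 0 < t) :
    laplaceIntegrand a (border B v b) (border A u (t + u ⬝ᵥ A⁻¹ *ᵥ u)) =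
      (detPow A (a - ((p : ℂ) + 2) / 2) * (Real.exp (-(A * B).trace) : ℝ) *
        (Real.exp (-(2 * (u ⬝ᵥ v) + b * (u ⬝ᵥ A⁻¹ *ᵥ u))) : ℝ)) *
      ((t : ℂ) ^ (a - p / 2 - 1) * (Real.exp (-(b * t)) : ℝ)) := by
  -- In size p + 1 the exponent is a - (p+2)/2, which on `t` reads (a - p/2) - 1, a Gamma kernel.
  have h1 : detPow (border A u (t + u ⬝ᵥ A⁻¹ *ᵥ u)) (a - (((p + 1 : ℕ) : ℂ) + 1) / 2) =
      detPow A (a - ((p : ℂ) + 2) / 2) * (t : ℂ) ^ (a - p / 2 - 1) := by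
    rw [detPow, detPow, det_border hA, Complex.ofReal_mul,
      Complex.mul_cpow_ofReal_nonneg hA.det_pos.le ht.le]
    congr 2 <;> (push_cast; ring)
  have h2 : Real.exp (-(border A u (t + u ⬝ᵥ A⁻¹ *ᵥ u) * border B v b).trace) =
      Real.exp (-(A * B).trace) * Real.exp (-(2 * (u ⬝ᵥ v) + b * (u ⬝ᵥ A⁻¹ *ᵥ u))) *
        Real.exp (-(b * t)) := by
    rw [trace_border_mul, ← Real.exp_add, ← Real.exp_add]; ring_nf
  rw [laplaceIntegrand, h1, h2]
  push_cast
  ring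

theorem trace_mul_sub_vecMulVec (A B : Mat p) (v : Fin p → ℝ) (b : ℝ) :
    (A * (B - b⁻¹ • vecMulVec v v)).trace = (A * B).trace - b⁻¹ * (v ⬝ᵥ A *ᵥ v) := by
  rw [Matrix.mul_sub, trace_sub, Matrix.mul_smul, trace_smul, mul_vecMulVec, trace_vecMulVec,
    dotProduct_comm, smul_eq_mul]

/-- The factor |A|^(1/2) from the Gaussian lifts the exponent a - (p+2)/2 to the a - (p+1)/2 of size
p, and the exponential of v · Av replaces B by its Schur complement. -/
theorem detPow_mul_gaussian (a : ℂ) {A : Mat p} (hA : A.PosDef) (B : Mat p) (v : Fin p → ℝ)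
    (b : ℝ) :
    detPow A (a - ((p : ℂ) + 2) / 2) * (Real.exp (-(A * B).trace) : ℝ) *
      (((π / b) ^ ((p : ℝ) / 2) * A.det ^ (1 / 2 : ℝ) * Real.exp (b⁻¹ * (v ⬝ᵥ A *ᵥ v)) : ℝ) : ℂ) =
    (((π / b) ^ ((p : ℝ) / 2) : ℝ) : ℂ) * laplaceIntegrand a (B - b⁻¹ • vecMulVec v v) A := by
  have h1 : detPow A (a - ((p : ℂ) + 1) / 2) =
      detPow A (a - ((p : ℂ) + 2) / 2) * ((A.det ^ (1 / 2 : ℝ) : ℝ) : ℂ) := by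
    rw [← detPow_ofReal hA, ← detPow_add hA]; congr 1; push_cast; ring
  have h2 : Real.exp (-(A * (B - b⁻¹ • vecMulVec v v)).trace) =
      Real.exp (-(A * B).trace) * Real.exp (b⁻¹ * (v ⬝ᵥ A *ᵥ v)) := by
    rw [trace_mul_sub_vecMulVec, ← Real.exp_add]; ring_nf
  rw [laplaceIntegrand, h1, h2]
  push_cast
  ring

/-- Integrating out the border column `u`, a Gaussian integral, leaves the Laplace integrand of the
Schur complement of the last diagonal entry. -/
theorem border_column_integral (a : ℂ) (B : Mat p) (v : Fin p → ℝ) {b : ℝ} (hb : 0 < b)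
    (hI : IntegrableOn (laplaceIntegrand a (B - b⁻¹ • vecMulVec v v)) (posCone p) (symVol p)) :
    Integrable (fun q : Mat p × (Fin p → ℝ) =>
      detPow q.1 (a - ((p : ℂ) + 2) / 2) * (Real.exp (-(q.1 * B).trace) : ℝ) *
        (Real.exp (-(2 * (q.2 ⬝ᵥ v) + b * (q.2 ⬝ᵥ q.1⁻¹ *ᵥ q.2))) : ℝ))
      (((symVol p).restrict (posCone p)).prod volume) ∧
    ∫ q : Mat p × (Fin p → ℝ),
      detPow q.1 (a - ((p : ℂ) + 2) / 2) * (Real.exp (-(q.1 * B).trace) : ℝ) *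
        (Real.exp (-(2 * (q.2 ⬝ᵥ v) + b * (q.2 ⬝ᵥ q.1⁻¹ *ᵥ q.2))) : ℝ)
      ∂(((symVol p).restrict (posCone p)).prod volume) =
    (((π / b) ^ ((p : ℝ) / 2) : ℝ) : ℂ) *
      ∫ A in posCone p, laplaceIntegrand a (B - b⁻¹ • vecMulVec v v) A ∂(symVol p) := by
  have hmeas : Measurable (fun q : Mat p × (Fin p → ℝ) =>
      detPow q.1 (a - ((p : ℂ) + 2) / 2) * (Real.exp (-(q.1 * B).trace) : ℝ) *
        (Real.exp (-(2 * (q.2 ⬝ᵥ v) + b * (q.2 ⬝ᵥ q.1⁻¹ *ᵥ q.2))) : ℝ)) := by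
    refine (((measurable_detPow _).comp measurable_fst).mul ?_).mul ?_
    · refine Complex.measurable_ofReal.comp (Real.measurable_exp.comp (Continuous.measurable ?_))
      exact (continuous_fst.matrix_mul continuous_const).matrix_trace.neg
    · refine Complex.measurable_ofReal.comp (Real.measurable_exp.comp (Measurable.neg ?_))
      refine Measurable.add (Continuous.measurable ?_) (measurable_quadForm_inv.const_mul b)
      exact continuous_const.mul (continuous_snd.dotProduct continuous_const)
  have hae : ∀ᵐ A ∂((symVol p).restrict (posCone p)), A.PosDef :=
    ae_restrict_mem measurableSet_posCone
  have hint : Integrable (fun q : Mat p × (Fin p → ℝ) =>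
      detPow q.1 (a - ((p : ℂ) + 2) / 2) * (Real.exp (-(q.1 * B).trace) : ℝ) *
        (Real.exp (-(2 * (q.2 ⬝ᵥ v) + b * (q.2 ⬝ᵥ q.1⁻¹ *ᵥ q.2))) : ℝ))
      (((symVol p).restrict (posCone p)).prod volume) := by
    rw [integrable_prod_iff hmeas.aestronglyMeasurable]
    constructor
    · filter_upwards [hae] with A hA
      exact ((gaussian_quadForm_inv hA hb v).1.ofReal).const_mul _
    · refine (hI.norm.const_mul ((π / b) ^ ((p : ℝ) / 2))).congr ?_
      filter_upwards [hae] with A hA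
      simp only [norm_mul, Complex.norm_real, Real.norm_of_nonneg (Real.exp_pos _).le]
      rw [integral_const_mul, (gaussian_quadForm_inv hA hb v).2]
      have h := congrArg norm (detPow_mul_gaussian a hA B v b)
      have hd := hA.det_pos
      rw [norm_mul, norm_mul, norm_mul, Complex.norm_real, Complex.norm_real, Complex.norm_real,
        Real.norm_of_nonneg (Real.exp_pos _).le, Real.norm_of_nonneg (by positivity),
        Real.norm_of_nonneg (by positivity)] at h
      exact h.symm
  refine ⟨hint, ?_⟩
  rw [integral_prod _ hint, ← integral_const_mul]
  refine integral_congr_ae ?_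
  filter_upwards [hae] with A hA
  rw [integral_const_mul, integral_complex_ofReal, (gaussian_quadForm_inv hA hb v).2,
    detPow_mul_gaussian a hA]

/-- The Laplace transform of a power of the determinant on the positive definite cone. -/
theorem laplace_detPow {p : ℕ} {a : ℂ} (ha : ((p : ℝ) - 1) / 2 < a.re) {V : Mat p}
    (hV : V.PosDef) :
    IntegrableOn (laplaceIntegrand a V) (posCone p) (symVol p) ∧
    ∫ W in posCone p, laplaceIntegrand a V W ∂(symVol p) = matGamma p a * detPow V (-a) := by
  induction p with
  | zero =>
    -- There is a single 0 × 0 matrix, of mass one, and both sides are 1.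
    have hL (W : Mat 0) : laplaceIntegrand a V W = 1 := by
      simp [laplaceIntegrand, detPow, trace]
    have hcone : posCone 0 = univ := by
      ext X; simp [posCone, Subsingleton.elim X V, hV]
    have hprob : IsProbabilityMeasure (symVol 0) := by
      have : IsProbabilityMeasure (volume : Measure (Sym2 (Fin 0) → ℝ)) :=
        ⟨by rw [volume_pi, Measure.pi_univ, Finset.univ_eq_empty, Finset.prod_empty]⟩
      exact Measure.isProbabilityMeasure_map measurable_symMat.aemeasurable
    rw [hcone, Measure.restrict_univ, IntegrableOn, Measure.restrict_univ,
      show laplaceIntegrand a V = fun _ => 1 from funext hL]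
    exact ⟨integrable_const _, by simp [matGamma, detPow]⟩
  | succ p ih =>
    obtain ⟨B, v, b, rfl⟩ := exists_border_eq (isSymm_of_posDef hV)
    obtain ⟨hb, hS⟩ := posDef_of_posDef_border hV
    push_cast at ha
    -- The bound Re a > p/2 for size p + 1 covers both the inductive bound (p-1)/2 and convergence
    -- of the Gamma integral at a - p/2.
    obtain ⟨i1, i2⟩ := ih (by linarith) hS
    have hc : 0 < (a - (p : ℂ) / 2).re := by
      rw [show (p : ℂ) / 2 = (((p : ℝ) / 2 : ℝ) : ℂ) by push_cast; rfl, Complex.sub_re,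
        Complex.ofReal_re]
      linarith
    obtain ⟨g1, g2⟩ := gamma_kernel hc hb
    obtain ⟨c1, c2⟩ := border_column_integral a B v hb i1
    have hmp := measurePreserving_border_posCone (p := p)
    have hm : Measurable (laplaceIntegrand a (border B v b)) :=
      measurable_laplaceIntegrand_right a _
    have hae : ∀ᵐ q ∂((((symVol p).restrict (posCone p)).prod
        (volume : Measure (Fin p → ℝ))).prod (volume.restrict (Ioi (0 : ℝ)))),
        q.1.1.PosDef ∧ 0 < q.2 := by
      have h1 : ∀ᵐ A ∂((symVol p).restrict (posCone p)), A.PosDef :=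
        ae_restrict_mem measurableSet_posCone
      have h2 : ∀ᵐ t ∂((volume : Measure ℝ).restrict (Ioi (0 : ℝ))), 0 < t :=
        ae_restrict_mem measurableSet_Ioi
      exact ((Measure.quasiMeasurePreserving_fst.comp
        Measure.quasiMeasurePreserving_fst).ae h1).and (Measure.quasiMeasurePreserving_snd.ae h2)
    have heq := hae.mono fun q hq => laplaceIntegrand_border a B q.1.1 v q.1.2 b hq.1 hq.2
    constructor
    · rw [IntegrableOn, ← hmp.integrable_comp hm.aestronglyMeasurable]
      exact (c1.mul_prod g1).congr (heq.mono fun q hq => hq.symm)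
    · rw [← hmp.map_eq, integral_map hmp.measurable.aemeasurable hm.aestronglyMeasurable,
        integral_congr_ae heq,
        integral_prod_mul (fun q : Mat p × (Fin p → ℝ) =>
          detPow q.1 (a - ((p : ℂ) + 2) / 2) * (Real.exp (-(q.1 * B).trace) : ℝ) *
            (Real.exp (-(2 * (q.2 ⬝ᵥ v) + b * (q.2 ⬝ᵥ q.1⁻¹ *ᵥ q.2))) : ℝ))
          (fun t : ℝ => (t : ℂ) ^ (a - p / 2 - 1) * (Real.exp (-(b * t)) : ℝ)), c2, i2, g2, matGamma_succ, detPow, detPow,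
        det_border' B v hb.ne', Complex.ofReal_mul,
        Complex.mul_cpow_ofReal_nonneg hb.le hS.det_pos.le,
        Complex.ofReal_cpow (by positivity), Complex.ofReal_div,
        show (((p : ℝ) / 2 : ℝ) : ℂ) = (p : ℂ) / 2 by push_cast; rfl]
      -- The Gaussian contributes b^(-p/2) and the Gamma integral b^(-(a-p/2)); together they give
      -- the b^(-a) needed for |V|^(-a).
      have hpow : ((π : ℂ) / b) ^ ((p : ℂ) / 2) * (b : ℂ) ^ (-(a - (p : ℂ) / 2)) =
          (π : ℂ) ^ ((p : ℂ) / 2) * (b : ℂ) ^ (-a) := by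
        have hb' : (b : ℂ) ≠ 0 := Complex.ofReal_ne_zero.2 hb.ne'
        rw [Complex.div_cpow_ofReal_nonneg Real.pi_pos.le hb.le, neg_sub, sub_eq_add_neg,
          Complex.cpow_add _ _ hb']
        have hne : (b : ℂ) ^ ((p : ℂ) / 2) ≠ 0 := Complex.cpow_ne_zero_iff.2 (.inl hb')
        field_simp
      linear_combination (matGamma p a *
        ((B - b⁻¹ • vecMulVec v v).det : ℂ) ^ (-a) * Complex.Gamma (a - p / 2)) * hpow

/-! ### Norms and products of Laplace integrands -/

theorem ae_posDef : ∀ᵐ A ∂((symVol p).restrict (posCone p)), A.PosDef :=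
  ae_restrict_mem measurableSet_posCone

theorem ofReal_norm_detPow {X : Mat p} (hX : X.PosDef) (a : ℂ) :
    (‖detPow X a‖ : ℂ) = detPow X (a.re : ℂ) := by
  rw [norm_detPow hX, detPow_ofReal hX]

theorem sub_half_re (a : ℂ) : (a - ((p : ℂ) + 1) / 2).re = a.re - ((p : ℝ) + 1) / 2 := by
  rw [show ((p : ℂ) + 1) / 2 = (((p : ℝ) + 1) / 2 : ℝ) by push_cast; ring, Complex.sub_re,
    Complex.ofReal_re]

theorem integral_norm_laplaceIntegrand {a : ℂ} (ha : ((p : ℝ) - 1) / 2 < a.re) {V : Mat p}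
    (hV : V.PosDef) :
    ∫ W in posCone p, ‖laplaceIntegrand a V W‖ ∂(symVol p) =
      ‖matGamma p a.re‖ * ‖detPow V (-a)‖ := by
  have h1 : ((∫ W in posCone p, ‖laplaceIntegrand a V W‖ ∂(symVol p) : ℝ) : ℂ) =
      matGamma p a.re * detPow V (-(a.re : ℂ)) := by
    rw [← integral_complex_ofReal, ← (laplace_detPow (a := (a.re : ℂ)) (by simpa using ha) hV).2]
    exact integral_congr_ae (ae_posDef.mono fun W hW => norm_laplaceIntegrand a V hW)
  have h2 := congrArg norm h1
  rw [Complex.norm_real, Real.norm_of_nonneg (integral_nonneg fun _ => norm_nonneg _),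
    norm_mul] at h2
  rw [h2, norm_detPow hV, norm_detPow hV]
  simp

/-- Since exp(-tr W(Z+V)) factors, the integrand can be read as a Laplace transform either in W,
with parameter Z + V, or in Z, with parameter W. -/
theorem detPow_mul_laplaceIntegrand_add (a b : ℂ) (V Z W : Mat p) :
    detPow Z (a - ((p : ℂ) + 1) / 2) * laplaceIntegrand (a + b) (Z + V) W =
      laplaceIntegrand a W Z * laplaceIntegrand (a + b) V W := by
  have h : Real.exp (-(W * (Z + V)).trace) =
      Real.exp (-(Z * W).trace) * Real.exp (-(W * V).trace) := by
    rw [Matrix.mul_add, trace_add, trace_mul_comm W Z, ← Real.exp_add]; ring_nf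
  rw [laplaceIntegrand, laplaceIntegrand, laplaceIntegrand, h]
  push_cast
  ring

theorem detPow_neg_mul_laplaceIntegrand (a b : ℂ) (V : Mat p) {W : Mat p} (hW : W.PosDef) :
    detPow W (-a) * laplaceIntegrand (a + b) V W = laplaceIntegrand b V W := by
  rw [laplaceIntegrand, laplaceIntegrand, ← mul_assoc, ← detPow_add hW]
  ring_nf

/-! ### The matrix-variate beta integral of the second kind -/

/-- The beta integral of the second kind on the positive definite cone. -/
theorem beta_detPow {a b : ℂ} (ha : ((p : ℝ) - 1) / 2 < a.re) (hb : ((p : ℝ) - 1) / 2 < b.re)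
    (hab : ((p : ℝ) - 1) / 2 < (a + b).re) {V : Mat p} (hV : V.PosDef) :
    IntegrableOn (fun Z => detPow Z (a - ((p : ℂ) + 1) / 2) * detPow (Z + V) (-(a + b)))
      (posCone p) (symVol p) ∧
    ∫ Z in posCone p, detPow Z (a - ((p : ℂ) + 1) / 2) * detPow (Z + V) (-(a + b)) ∂(symVol p) =
      matGamma p a * matGamma p b / matGamma p (a + b) * detPow V (-b) := by
  set μ := (symVol p).restrict (posCone p) with hμ
  -- Integrating `F` over W first gives Γ_p(a+b) times the beta integrand; over Z first it gives
  -- Γ_p(a) |W|^(-a), leaving a Laplace transform of exponent b.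
  let F : Mat p → Mat p → ℂ := fun Z W => laplaceIntegrand a W Z * laplaceIntegrand (a + b) V W
  have hFm : Measurable (Function.uncurry F) :=
    ((measurable_laplaceIntegrand a).comp measurable_swap).mul
      ((measurable_laplaceIntegrand_right (a + b) V).comp measurable_snd)
  have hF : Integrable (Function.uncurry F) (μ.prod μ) := by
    rw [integrable_prod_iff' hFm.aestronglyMeasurable]
    constructor
    · filter_upwards [ae_posDef] with W hW
      exact Integrable.mul_const (laplace_detPow ha hW).1 (laplaceIntegrand (a + b) V W)
    · refine ((laplace_detPow hb hV).1.norm.const_mul ‖matGamma p a.re‖).congr ?_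
      filter_upwards [ae_posDef] with W hW
      simp only [F, Function.uncurry, norm_mul]
      rw [integral_mul_const, integral_norm_laplaceIntegrand ha hW,
        ← detPow_neg_mul_laplaceIntegrand a b V hW, norm_mul, mul_assoc]
  have hinner : (fun Z => ∫ W, F Z W ∂μ) =ᵐ[μ] fun Z => matGamma p (a + b) *
      (detPow Z (a - ((p : ℂ) + 1) / 2) * detPow (Z + V) (-(a + b))) := by
    filter_upwards [ae_posDef] with Z hZ
    simp only [F, ← detPow_mul_laplaceIntegrand_add]
    rw [integral_const_mul, (laplace_detPow hab (hZ.add hV)).2]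
    ring
  have h0 := matGamma_ne_zero hab
  constructor
  · exact (integrable_const_mul_iff h0.isUnit _).1 (hF.integral_prod_left.congr hinner)
  · have h1 := integral_integral_swap hF
    rw [integral_congr_ae hinner, integral_const_mul] at h1
    have h2 : ∫ W, ∫ Z, F Z W ∂μ ∂μ = matGamma p a * (matGamma p b * detPow V (-b)) := by
      rw [← (laplace_detPow hb hV).2, ← integral_const_mul]
      refine integral_congr_ae ?_
      filter_upwards [ae_posDef] with W hW
      simp only [F]
      rw [integral_mul_const, (laplace_detPow ha hW).2, mul_assoc,
        detPow_neg_mul_laplaceIntegrand a b V hW]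
    rw [h2] at h1
    rw [div_mul_eq_mul_div, eq_div_iff h0, mul_comm, h1, mul_assoc]

theorem integral_norm_beta {a b : ℂ} (ha : ((p : ℝ) - 1) / 2 < a.re)
    (hb : ((p : ℝ) - 1) / 2 < b.re) (hab : ((p : ℝ) - 1) / 2 < (a + b).re) {V : Mat p}
    (hV : V.PosDef) :
    ∫ Z in posCone p, ‖detPow Z (a - ((p : ℂ) + 1) / 2) * detPow (Z + V) (-(a + b))‖ ∂(symVol p) =
      ‖matGamma p a.re * matGamma p b.re / matGamma p (a.re + b.re)‖ * ‖detPow V (-b)‖ := by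
  have h1 : ((∫ Z in posCone p, ‖detPow Z (a - ((p : ℂ) + 1) / 2) *
        detPow (Z + V) (-(a + b))‖ ∂(symVol p) : ℝ) : ℂ) =
      matGamma p a.re * matGamma p b.re / matGamma p (a.re + b.re) * detPow V (-(b.re : ℂ)) := by
    rw [← integral_complex_ofReal, ← (beta_detPow (a := (a.re : ℂ)) (b := (b.re : ℂ))
      (by simpa using ha) (by simpa using hb) (by simpa using hab) hV).2]
    refine integral_congr_ae (ae_posDef.mono fun Z hZ => ?_)
    simp only
    rw [norm_mul, Complex.ofReal_mul, ofReal_norm_detPow hZ, ofReal_norm_detPow (hZ.add hV),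
      sub_half_re]
    simp
  have h2 := congrArg norm h1
  rw [Complex.norm_real, Real.norm_of_nonneg (integral_nonneg fun _ => norm_nonneg _),
    norm_mul] at h2
  rw [h2, norm_detPow hV, norm_detPow hV]
  simp

/-! ### The fractional integral -/

theorem measurableSet_sub_mem_posCone (V : Mat p) : MeasurableSet {X : Mat p | X - V ∈ posCone p} :=
  (continuous_id.sub continuous_const).measurable measurableSet_posCone

/-- X > V > O already forces X > O. -/
theorem restrict_posCone_restrict_sub {V : Mat p} (hV : V.PosDef) :
    ((symVol p).restrict (posCone p)).restrict {X | X - V ∈ posCone p} =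
      (symVol p).restrict {X | X - V ∈ posCone p} := by
  refine Measure.restrict_restrict_of_subset fun X hX => ?_
  have h : (X - V + V).PosDef := PosDef.add hX hV
  rwa [sub_add_cancel] at h

theorem measurePreserving_add_posCone {V : Mat p} (hV : V.PosDef) :
    MeasurePreserving (fun Z => Z + V) ((symVol p).restrict (posCone p))
      ((symVol p).restrict {X | X - V ∈ posCone p}) := by
  have h := (measurePreserving_add_left (isSymm_of_posDef hV)).restrict_preimage
    (measurableSet_sub_mem_posCone V)
  simpa using h

/-- The kernel `|X| ^ (-c) |X - V| ^ (a - (p+1)/2) f(V)` on `V < X`. -/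
def rlKernel (a c : ℂ) (f : Mat p → ℂ) (X V : Mat p) : ℂ :=
  {Y : Mat p | Y - V ∈ posCone p}.indicator
    (fun Y => detPow (Y - V) (a - ((p : ℂ) + 1) / 2) * detPow Y (-c) * f V) X

theorem measurable_detPow_sub_mul (a c : ℂ) (V : Mat p) : Measurable fun Y : Mat p =>
    detPow (Y - V) a * detPow Y c :=
  ((measurable_detPow a).comp (continuous_id.sub continuous_const).measurable).mul
    (measurable_detPow c)

/-- For fixed V, the translation X = Z + V yields the beta integral, with f(V) as a constant factor.
-/
theorem rlKernel_left {a b : ℂ} (ha : ((p : ℝ) - 1) / 2 < a.re)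
    (hb : ((p : ℝ) - 1) / 2 < b.re) (hab : ((p : ℝ) - 1) / 2 < (a + b).re) (f : Mat p → ℂ)
    {V : Mat p} (hV : V.PosDef) :
    Integrable (fun X => rlKernel a (a + b) f X V) ((symVol p).restrict (posCone p)) ∧
    ∫ X in posCone p, rlKernel a (a + b) f X V ∂(symVol p) =
      matGamma p a * matGamma p b / matGamma p (a + b) * (detPow V (-b) * f V) ∧
    ∫ X in posCone p, ‖rlKernel a (a + b) f X V‖ ∂(symVol p) =
      ‖matGamma p a.re * matGamma p b.re / matGamma p (a.re + b.re)‖ * ‖detPow V (-b) * f V‖ := by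
  have hS := measurableSet_sub_mem_posCone V
  have hmp := measurePreserving_add_posCone hV
  have hG := measurable_detPow_sub_mul (a - ((p : ℂ) + 1) / 2) (-(a + b)) V
  obtain ⟨b1, b2⟩ := beta_detPow ha hb hab hV
  refine ⟨?_, ?_, ?_⟩
  · simp only [rlKernel]
    rw [integrable_indicator_iff hS, IntegrableOn, restrict_posCone_restrict_sub hV]
    refine Integrable.mul_const ?_ _
    rw [← hmp.integrable_comp hG.aestronglyMeasurable]
    simpa only [Function.comp_def, add_sub_cancel_right, IntegrableOn] using b1
  · simp only [rlKernel]
    rw [integral_indicator hS, restrict_posCone_restrict_sub hV, integral_mul_const, ← hmp.map_eq,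
      integral_map hmp.measurable.aemeasurable hG.aestronglyMeasurable]
    simp only [add_sub_cancel_right]
    rw [b2, mul_assoc]
  · simp only [rlKernel, norm_indicator_eq_indicator_norm]
    rw [integral_indicator hS, restrict_posCone_restrict_sub hV]
    simp only [norm_mul _ (f V)]
    rw [integral_mul_const, ← hmp.map_eq,
      integral_map hmp.measurable.aemeasurable hG.norm.aestronglyMeasurable]
    simp only [add_sub_cancel_right]
    rw [integral_norm_beta ha hb hab hV, mul_assoc]

/-- Divide the integrand by the determinant power, which does not vanish on the cone. -/
theorem aestronglyMeasurable_of_hasMTransform {f : Mat p → ℂ} {s : ℂ} (hf : HasMTransform f s) :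
    AEStronglyMeasurable f ((symVol p).restrict (posCone p)) := by
  have hI : Integrable (mIntegrand f s) ((symVol p).restrict (posCone p)) := hf
  have h := ((measurable_detPow (p := p) (s - ((p : ℂ) + 1) / 2)).inv.aestronglyMeasurable
    (μ := (symVol p).restrict (posCone p))).mul hI.aestronglyMeasurable
  refine h.congr (ae_posDef.mono fun X hX => ?_)
  simp [mIntegrand, detPow_ne_zero hX]

theorem aestronglyMeasurable_rlKernel (a c : ℂ) {f : Mat p → ℂ} {μ : Measure (Mat p)} [SFinite μ]
    (hf : AEStronglyMeasurable f μ) :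
    AEStronglyMeasurable (Function.uncurry (rlKernel a c f)) (μ.prod μ) := by
  have hsub : Measurable fun q : Mat p × Mat p => q.1 - q.2 :=
    (continuous_fst.sub continuous_snd).measurable
  have hS : MeasurableSet {q : Mat p × Mat p | q.1 - q.2 ∈ posCone p} :=
    hsub measurableSet_posCone
  have h1 : Measurable fun q : Mat p × Mat p =>
      detPow (q.1 - q.2) (a - ((p : ℂ) + 1) / 2) * detPow q.1 (-c) :=
    ((measurable_detPow _).comp hsub).mul ((measurable_detPow _).comp measurable_fst)
  exact (h1.aestronglyMeasurable.mul hf.comp_snd).indicator hS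

theorem integrable_rlKernel {a b : ℂ} (ha : ((p : ℝ) - 1) / 2 < a.re)
    (hb : ((p : ℝ) - 1) / 2 < b.re) (hab : ((p : ℝ) - 1) / 2 < (a + b).re) {f : Mat p → ℂ}
    (hf : AEStronglyMeasurable f ((symVol p).restrict (posCone p)))
    (hI : Integrable (fun V => detPow V (-b) * f V) ((symVol p).restrict (posCone p))) :
    Integrable (Function.uncurry (rlKernel a (a + b) f))
      (((symVol p).restrict (posCone p)).prod ((symVol p).restrict (posCone p))) := by
  rw [integrable_prod_iff' (aestronglyMeasurable_rlKernel a (a + b) hf)]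
  refine ⟨ae_posDef.mono fun V hV => (rlKernel_left ha hb hab f hV).1, ?_⟩
  exact (hI.norm.const_mul _).congr
    (ae_posDef.mono fun V hV => (rlKernel_left ha hb hab f hV).2.2.symm)

theorem measurableSet_setOf_sub_mem (X : Mat p) : MeasurableSet {V : Mat p | X - V ∈ posCone p} :=
  (continuous_const.sub continuous_id).measurable measurableSet_posCone

theorem restrict_posCone_restrict_below (X : Mat p) :
    ((symVol p).restrict (posCone p)).restrict {V | X - V ∈ posCone p} =
      (symVol p).restrict (below X) := by
  rw [Measure.restrict_restrict (measurableSet_setOf_sub_mem X), inter_comm]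
  rfl

/-- Passes from the X-section of the kernel to its V-section, where the cutoff V < X produces the
fractional integral. -/
theorem rlKernel_eq_indicator (a c : ℂ) (f : Mat p → ℂ) (X V : Mat p) :
    rlKernel a c f X V =
      detPow X (-c) * {V | X - V ∈ posCone p}.indicator (rlIntegrand a f X) V := by
  by_cases h : X - V ∈ posCone p
  · rw [rlKernel, indicator_of_mem (by exact h), indicator_of_mem (by exact h), rlIntegrand]
    ring
  · rw [rlKernel, indicator_of_notMem (by exact h), indicator_of_notMem (by exact h), mul_zero]

theorem integral_rlKernel_right (a c : ℂ) (f : Mat p → ℂ) (X : Mat p) :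
    ∫ V in posCone p, rlKernel a c f X V ∂(symVol p) =
      detPow X (-c) * ∫ V in below X, rlIntegrand a f X V ∂(symVol p) := by
  simp only [rlKernel_eq_indicator]
  rw [integral_const_mul, integral_indicator (measurableSet_setOf_sub_mem X),
    restrict_posCone_restrict_below]

theorem integrableOn_below_of_rlKernel {a c : ℂ} {f : Mat p → ℂ} {X : Mat p} (hX : X.PosDef)
    (h : Integrable (rlKernel a c f X) ((symVol p).restrict (posCone p))) :
    IntegrableOn (rlIntegrand a f X) (below X) (symVol p) := by
  rw [show rlKernel a c f X = fun V => detPow X (-c) *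
      {V | X - V ∈ posCone p}.indicator (rlIntegrand a f X) V from
    funext (rlKernel_eq_indicator a c f X),
    integrable_const_mul_iff (detPow_ne_zero hX _).isUnit] at h
  have h2 := (integrable_indicator_iff (measurableSet_setOf_sub_mem X)).1 h
  rwa [IntegrableOn, restrict_posCone_restrict_below] at h2

end MatrixVariate

end

theorem corollary5p1p1 (p : ℕ) (hp : 1 ≤ p) (α s : ℂ)
    (hα : ((p : ℝ) - 1) / 2 < α.re) (hs : s.re < 1)
    (f : MatrixVariate.Mat p → ℂ) (hf : MatrixVariate.HasMTransform f s) :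
    (∀ᵐ X ∂((MatrixVariate.symVol p).restrict (MatrixVariate.posCone p)),
      IntegrableOn (MatrixVariate.rlIntegrand α f X) (MatrixVariate.below X)
        (MatrixVariate.symVol p)) ∧
    MatrixVariate.HasMTransform
      (fun X => MatrixVariate.detPow X (-α) * MatrixVariate.leftRL α f X) s ∧
    MatrixVariate.mTransform
      (fun X => MatrixVariate.detPow X (-α) * MatrixVariate.leftRL α f X) s =
      MatrixVariate.matGamma p (((p : ℂ) + 1) / 2 - s) /
        MatrixVariate.matGamma p (((p : ℂ) + 1) / 2 + α - s) *
        MatrixVariate.mTransform f s := by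
  open MatrixVariate in
  set b : ℂ := ((p : ℂ) + 1) / 2 - s with hbdef
  have hbre : b.re = ((p : ℝ) + 1) / 2 - s.re := by
    have h := sub_half_re (p := p) s
    rw [show b = -(s - ((p : ℂ) + 1) / 2) by rw [hbdef]; ring, Complex.neg_re, h]; ring
  -- This is exactly the condition Re s < 1.
  have hb : ((p : ℝ) - 1) / 2 < b.re := by rw [hbre]; linarith
  have hp' : (1 : ℝ) ≤ p := by exact_mod_cast hp
  -- The two bounds add up to p - 1, which is at least (p-1)/2 because p ≥ 1.
  have hab : ((p : ℝ) - 1) / 2 < (α + b).re := by rw [Complex.add_re]; linarith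
  have hnb : s - ((p : ℂ) + 1) / 2 = -b := by rw [hbdef]; ring
  have hI : Integrable (fun V => detPow V (-b) * f V) ((symVol p).restrict (posCone p)) := by
    have h : IntegrableOn (mIntegrand f s) (posCone p) (symVol p) := hf
    simpa only [IntegrableOn, funext (fun V => show mIntegrand f s V = detPow V (-b) * f V by
      rw [mIntegrand, hnb])] using h
  have hK := integrable_rlKernel hα hb hab (aestronglyMeasurable_of_hasMTransform hf) hI
  have hM : mIntegrand (fun X => detPow X (-α) * leftRL α f X) s
      =ᵐ[(symVol p).restrict (posCone p)]
      fun X => (1 / matGamma p α) * ∫ V in posCone p, rlKernel α (α + b) f X V ∂(symVol p) := by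
    filter_upwards [ae_posDef] with X hX
    rw [mIntegrand, hnb, leftRL, integral_rlKernel_right, neg_add, detPow_add hX]
    ring
  refine ⟨?_, ?_, ?_⟩
  -- Joint integrability of the kernel makes almost every V-section integrable.
  · filter_upwards [ae_posDef, hK.prod_right_ae] with X hX h
    exact integrableOn_below_of_rlKernel hX h
  · exact (hK.integral_prod_left.const_mul _).congr hM.symm
  · have h0 := matGamma_ne_zero hα
    rw [mTransform, integral_congr_ae hM, integral_const_mul, integral_integral_swap hK,
      integral_congr_ae (ae_posDef.mono fun V hV => (rlKernel_left hα hb hab f hV).2.1),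
      integral_const_mul, mTransform, show ((p : ℂ) + 1) / 2 + α - s = α + b by rw [hbdef]; ring]
    simp only [mIntegrand, hnb]
    field_simp
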